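/- Theorem (No-Go Theorem). Let $s>0$ and let $\mathcal P=\mathbb R[S_1,S_2,S_3]/(S_1^2+S_2^2+S_3^2-s^2)$ be the algebra of real polynomials in $S_1,S_2,S_3$ restricted to the sphere $S^2\subset\mathbb R^3$ of radius $s$, with the Poisson bracket $$\{f,g\}=\sum_{i,j,k=1}^3\epsilon_{ijk}\,S_i\,\frac{\partial f}{\partial S_j}\,\frac{\partial g}{\partial S_k},$$ and let $\mathcal P^1=\operatorname{span}_{\mathbb R}\{1,S_1,S_2,S_3\}$. A quantization of $\mathcal P$ on a complex Hilbert space $\mathcal H$ is a real-linear map $\mathcal Q$ from $\mathcal P$ to the (everywhere defined, hence bounded) self-adjoint operators on $\mathcal H$ such that $\mathcal Q(\{f,g\})=-\mathrm i\,[\mathcal Q(f),\mathcal Q(g)]$ for all $f,g\in\mathcal P$ and $\mathcal Q(1)=I$. It is an admissible quantization of $(\mathcal P,\mathcal P^1)$ if it is irreducible on $\mathcal P^1$, that is, if $\mathcal H\neq 0$ and the only closed subspaces of $\mathcal H$ invariant under all $\mathcal Q(f)$, $f\in\mathcal P^1$, are $0$ and $\mathcal H$. It is trivial (spin $j=0$)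 if $\mathcal Q(S_1)=\mathcal Q(S_2)=\mathcal Q(S_3)=0$. On no Hilbert space does there exist a nontrivial admissible quantization of $(\mathcal P,\mathcal P^1)$. -/

import Mathlib

noncomputable section

namespace SpinSphere

/-- The bracket `{f, g} = ∑ ε_{ijk} S_i (∂f/∂S_j) (∂g/∂S_k)` on real polynomials in the three
variables `S₁, S₂, S₃` (indexed here by `0, 1, 2 : Fin 3`), i.e. `S ⬝ (∇f × ∇g)`. -/
def polyBracket (f g : MvPolynomial (Fin 3) ℝ) : MvPolynomial (Fin 3) ℝ :=
  MvPolynomial.X 0 * (MvPolynomial.pderiv 1 f * MvPolynomial.pderiv 2 g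
      - MvPolynomial.pderiv 2 f * MvPolynomial.pderiv 1 g)
    + MvPolynomial.X 1 * (MvPolynomial.pderiv 2 f * MvPolynomial.pderiv 0 g
      - MvPolynomial.pderiv 0 f * MvPolynomial.pderiv 2 g)
    + MvPolynomial.X 2 * (MvPolynomial.pderiv 0 f * MvPolynomial.pderiv 1 g
      - MvPolynomial.pderiv 1 f * MvPolynomial.pderiv 0 g)

/-- The defining relation `S₁² + S₂² + S₃² - s²` of the sphere of radius `s`. -/
def sphereRel (s : ℝ) : MvPolynomial (Fin 3) ℝ :=
  MvPolynomial.X 0 ^ 2 + MvPolynomial.X 1 ^ 2 + MvPolynomial.X 2 ^ 2 - MvPolynomial.C (s ^ 2)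

/-- The algebra `𝒫` of polynomials in `S₁, S₂, S₃` modulo `S₁² + S₂² + S₃² = s²`. -/
abbrev SpherePoly (s : ℝ) : Type :=
  MvPolynomial (Fin 3) ℝ ⧸ Ideal.span {sphereRel s}

/-- The class in `𝒫` of a polynomial. -/
def toSphere (s : ℝ) : MvPolynomial (Fin 3) ℝ →ₐ[ℝ] SpherePoly s :=
  Ideal.Quotient.mkₐ ℝ (Ideal.span {sphereRel s})

/-- The component `S_{i+1}` of the spin vector, as an element of `𝒫`. -/
def S (s : ℝ) (i : Fin 3) : SpherePoly s := toSphere s (MvPolynomial.X i)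

theorem polyBracket_sub_left (f f' g : MvPolynomial (Fin 3) ℝ) :
    polyBracket (f - f') g = polyBracket f g - polyBracket f' g := by
  simp only [polyBracket, map_sub]; ring

theorem polyBracket_swap (f g : MvPolynomial (Fin 3) ℝ) :
    polyBracket f g = -polyBracket g f := by
  simp only [polyBracket]; ring

/-- The relation is a Casimir: its multiples bracket to multiples of the relation. -/
theorem polyBracket_rel_mul (s : ℝ) (f g : MvPolynomial (Fin 3) ℝ) :
    polyBracket (sphereRel s * f) g = sphereRel s * polyBracket f g := by
  have h0 : MvPolynomial.pderiv 0 (sphereRel s) = 2 * MvPolynomial.X (0 : Fin 3) := by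
    simp [sphereRel, MvPolynomial.pderiv_X]
  have h1 : MvPolynomial.pderiv 1 (sphereRel s) = 2 * MvPolynomial.X (1 : Fin 3) := by
    simp [sphereRel, MvPolynomial.pderiv_X]
  have h2 : MvPolynomial.pderiv 2 (sphereRel s) = 2 * MvPolynomial.X (2 : Fin 3) := by
    simp [sphereRel, MvPolynomial.pderiv_X]
  simp only [polyBracket, MvPolynomial.pderiv_mul, h0, h1, h2]
  ring

theorem toSphere_polyBracket_left (s : ℝ) {f f' : MvPolynomial (Fin 3) ℝ}
    (h : f - f' ∈ Ideal.span {sphereRel s}) (g : MvPolynomial (Fin 3) ℝ) :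
    toSphere s (polyBracket f g) = toSphere s (polyBracket f' g) := by
  obtain ⟨r, hr⟩ := Ideal.mem_span_singleton'.1 h
  refine Ideal.Quotient.eq.2 ?_
  rw [← polyBracket_sub_left, ← hr, mul_comm r, polyBracket_rel_mul]
  exact Ideal.mul_mem_right _ _ (Ideal.mem_span_singleton_self _)

theorem toSphere_polyBracket_congr (s : ℝ) {f f' g g' : MvPolynomial (Fin 3) ℝ}
    (hf : f - f' ∈ Ideal.span {sphereRel s}) (hg : g - g' ∈ Ideal.span {sphereRel s}) :
    toSphere s (polyBracket f g) = toSphere s (polyBracket f' g') := by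
  rw [toSphere_polyBracket_left s hf, polyBracket_swap f' g, polyBracket_swap f' g', map_neg,
    map_neg, toSphere_polyBracket_left s hg]

/-- The Poisson bracket of `𝒫`, computed on arbitrary polynomial representatives. -/
def poissonBracket {s : ℝ} (f g : SpherePoly s) : SpherePoly s :=
  Quotient.liftOn₂' f g (fun p q => toSphere s (polyBracket p q)) fun _ _ _ _ hf hg =>
    toSphere_polyBracket_congr s
      ((Submodule.quotientRel_def _).1 hf) ((Submodule.quotientRel_def _).1 hg)

theorem poissonBracket_toSphere (s : ℝ) (p q : MvPolynomial (Fin 3) ℝ) :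
    poissonBracket (toSphere s p) (toSphere s q) = toSphere s (polyBracket p q) := rfl

/-- The subspace `𝒫¹ = span {1, S₁, S₂, S₃}` of `𝒫`. -/
def basicObservables (s : ℝ) : Submodule ℝ (SpherePoly s) :=
  Submodule.span ℝ {1, S s 0, S s 1, S s 2}

/-- A quantization of `𝒫` on a Hilbert space `H`: a real-linear map from `𝒫` to the (everywhere
defined, hence bounded) self-adjoint operators on `H` with `Q {f, g} = -i [Q f, Q g]` and
`Q 1 = I`. -/
structure IsQuantization {s : ℝ} {H : Type*} [NormedAddCommGroup H] [InnerProductSpace ℂ H]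
    [CompleteSpace H] (Q : SpherePoly s →ₗ[ℝ] (H →L[ℂ] H)) : Prop where
  isSelfAdjoint : ∀ f, IsSelfAdjoint (Q f)
  map_bracket : ∀ f g, Q (poissonBracket f g) = (-Complex.I) • (Q f * Q g - Q g * Q f)
  map_one : Q 1 = 1

/-- `Q` represents the observables in `B` irreducibly: `H ≠ 0`, and the only closed subspaces of
`H` that are invariant under all `Q f`, `f ∈ B`, are `0` and `H`. -/
def IsIrreducibleOn {s : ℝ} {H : Type*} [NormedAddCommGroup H] [InnerProductSpace ℂ H]
    (Q : SpherePoly s →ₗ[ℝ] (H →L[ℂ] H)) (B : Set (SpherePoly s)) : Prop :=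
  Nontrivial H ∧ ∀ K : Submodule ℂ H, IsClosed (K : Set H) →
    (∀ f ∈ B, ∀ x ∈ K, Q f x ∈ K) → K = ⊥ ∨ K = ⊤

/-- An admissible quantization of the pair `(𝒫, 𝒫¹)`. -/
structure IsAdmissibleQuantization {s : ℝ} {H : Type*} [NormedAddCommGroup H]
    [InnerProductSpace ℂ H] [CompleteSpace H] (Q : SpherePoly s →ₗ[ℝ] (H →L[ℂ] H)) : Prop where
  isQuantization : IsQuantization Q
  isIrreducibleOn : IsIrreducibleOn Q (basicObservables s)

/-- The trivial (spin `j = 0`) case: the spin components are represented by zero. -/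
def IsSpinZero {s : ℝ} {H : Type*} [NormedAddCommGroup H] [InnerProductSpace ℂ H]
    (Q : SpherePoly s →ₗ[ℝ] (H →L[ℂ] H)) : Prop :=
  ∀ i, Q (S s i) = 0

end SpinSphere

end

namespace SpinSphere

open MvPolynomial

/-! Put z = S₁ + i S₂. Since {zⁿ, S₃} = i n zⁿ, boundedness of `Q S₃` forces `Q` to kill the real
and imaginary parts of zⁿ once n > 2‖Q S₃‖. The kernel of `Q` is a Lie ideal, so bracketing with S₃²
puts S₃zⁿ there too. With z̄ = S₁ - i S₂ and m ≥ 2, 3m {S₃zᵐ, z̄} - (2m+1) {zᵐ, S₃z̄} = -2i m(m-1)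
(S₁²+S₂²+S₃²) zᵐ⁻¹, the weights being chosen so that |z|² and S₃² get equal coefficients. On the
sphere the last factor is s² ≠ 0, so zᵐ⁻¹ is killed as well. Descent ends at z, and S₃ = {S₁, S₂}
follows. -/

/-- The pair of the real and the imaginary part of `(S₁ + i S₂) ^ n`. -/
noncomputable def sectorial : ℕ → MvPolynomial (Fin 3) ℝ × MvPolynomial (Fin 3) ℝ
  | 0 => (1, 0)
  | n + 1 => (X 0 * (sectorial n).1 - X 1 * (sectorial n).2,
      X 0 * (sectorial n).2 + X 1 * (sectorial n).1)

/-- The Cauchy–Riemann equations for zⁿ⁺¹, whose complex derivative is (n+1) zⁿ. -/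
theorem pderiv_sectorial_succ (n : ℕ) :
    pderiv 0 (sectorial (n + 1)).1 = ((n : MvPolynomial (Fin 3) ℝ) + 1) * (sectorial n).1 ∧
    pderiv 1 (sectorial (n + 1)).1 = -(((n : MvPolynomial (Fin 3) ℝ) + 1) * (sectorial n).2) ∧
    pderiv 0 (sectorial (n + 1)).2 = ((n : MvPolynomial (Fin 3) ℝ) + 1) * (sectorial n).2 ∧
    pderiv 1 (sectorial (n + 1)).2 = ((n : MvPolynomial (Fin 3) ℝ) + 1) * (sectorial n).1 := by
  induction n with
  | zero => simp [sectorial, pderiv_X]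
  | succ n ih =>
    obtain ⟨h1, h2, h3, h4⟩ := ih
    rw [sectorial]
    simp only [map_sub, map_add, pderiv_mul, h1, h2, h3, h4]
    simp only [pderiv_X, sectorial]
    push_cast
    refine ⟨?_, ?_, ?_, ?_⟩ <;> simp <;> ring

theorem pderiv_two_sectorial (n : ℕ) :
    pderiv 2 (sectorial n).1 = 0 ∧ pderiv 2 (sectorial n).2 = 0 := by
  induction n with
  | zero => simp [sectorial]
  | succ n ih => simp [sectorial, ih.1, ih.2, pderiv_X]

theorem polyBracket_sectorial_fst_X_two (n : ℕ) :
    polyBracket (sectorial n).1 (X 2) = -((n : ℝ) • (sectorial n).2) := by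
  cases n with
  | zero => simp [sectorial, polyBracket]
  | succ n =>
    obtain ⟨h1, h2, -, -⟩ := pderiv_sectorial_succ n
    simp only [polyBracket, h1, h2, smul_eq_C_mul]
    simp [pderiv_X, sectorial]
    ring

theorem polyBracket_sectorial_snd_X_two (n : ℕ) :
    polyBracket (sectorial n).2 (X 2) = (n : ℝ) • (sectorial n).1 := by
  cases n with
  | zero => simp [sectorial, polyBracket]
  | succ n =>
    obtain ⟨-, -, h3, h4⟩ := pderiv_sectorial_succ n
    simp only [polyBracket, h3, h4, smul_eq_C_mul]
    simp [pderiv_X, sectorial]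
    ring

theorem polyBracket_X_two_sq (f : MvPolynomial (Fin 3) ℝ) :
    polyBracket f (X 2 ^ 2) = 2 * (X 2 * polyBracket f (X 2)) := by
  simp only [polyBracket, pderiv_pow, pderiv_X]
  simp
  ring

/-- The lowering identity for the imaginary parts. -/
theorem lowering_snd (s : ℝ) (n : ℕ) :
    (3 * ((n : ℝ) + 2)) • (polyBracket (X 2 * (sectorial (n + 2)).1) (X 0)
        + polyBracket (X 2 * (sectorial (n + 2)).2) (X 1))
      - (2 * (n : ℝ) + 5) • (polyBracket (sectorial (n + 2)).1 (X 2 * X 0)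
        + polyBracket (sectorial (n + 2)).2 (X 2 * X 1))
      = (2 * ((n : ℝ) + 2) * ((n : ℝ) + 1)) • ((sphereRel s + C (s ^ 2)) *
        (sectorial (n + 1)).2) := by
  obtain ⟨h1, h2, h3, h4⟩ := pderiv_sectorial_succ (n + 1)
  obtain ⟨h5, h6⟩ := pderiv_two_sectorial (n + 2)
  simp only [polyBracket, pderiv_mul, h1, h2, h3, h4, h5, h6, smul_eq_C_mul, pderiv_X, sphereRel]
  have c2 : (C 2 : MvPolynomial (Fin 3) ℝ) = 2 := map_ofNat C 2
  have c3 : (C 3 : MvPolynomial (Fin 3) ℝ) = 3 := map_ofNat C 3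
  have c5 : (C 5 : MvPolynomial (Fin 3) ℝ) = 5 := map_ofNat C 5
  rw [sectorial]
  simp [c2, c3, c5]
  ring

/-- The lowering identity for the real parts. -/
theorem lowering_fst (s : ℝ) (n : ℕ) :
    (3 * ((n : ℝ) + 2)) • (polyBracket (X 2 * (sectorial (n + 2)).2) (X 0)
        - polyBracket (X 2 * (sectorial (n + 2)).1) (X 1))
      - (2 * (n : ℝ) + 5) • (polyBracket (sectorial (n + 2)).2 (X 2 * X 0)
        - polyBracket (sectorial (n + 2)).1 (X 2 * X 1))
      = -((2 * ((n : ℝ) + 2) * ((n : ℝ) + 1)) • ((sphereRel s + C (s ^ 2)) *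
        (sectorial (n + 1)).1)) := by
  obtain ⟨h1, h2, h3, h4⟩ := pderiv_sectorial_succ (n + 1)
  obtain ⟨h5, h6⟩ := pderiv_two_sectorial (n + 2)
  simp only [polyBracket, pderiv_mul, h1, h2, h3, h4, h5, h6, smul_eq_C_mul, pderiv_X, sphereRel]
  have c2 : (C 2 : MvPolynomial (Fin 3) ℝ) = 2 := map_ofNat C 2
  have c3 : (C 3 : MvPolynomial (Fin 3) ℝ) = 3 := map_ofNat C 3
  have c5 : (C 5 : MvPolynomial (Fin 3) ℝ) = 5 := map_ofNat C 5
  rw [sectorial]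
  simp [c2, c3, c5]
  ring

theorem toSphere_sphereRel (s : ℝ) : toSphere s (sphereRel s) = 0 :=
  Ideal.Quotient.eq_zero_iff_mem.2 (Ideal.mem_span_singleton_self _)

theorem toSphere_rel_add_mul (s : ℝ) (f : MvPolynomial (Fin 3) ℝ) :
    toSphere s ((sphereRel s + C (s ^ 2)) * f) = s ^ 2 • toSphere s f := by
  rw [add_mul, map_add, map_mul, toSphere_sphereRel, zero_mul, zero_add, ← smul_eq_C_mul,
    map_smul]

variable {s : ℝ} {H : Type*} [NormedAddCommGroup H] [InnerProductSpace ℂ H] [CompleteSpace H]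
  {Q : SpherePoly s →ₗ[ℝ] (H →L[ℂ] H)}

namespace IsQuantization

theorem map_polyBracket (hQ : IsQuantization Q) (f g : MvPolynomial (Fin 3) ℝ) :
    Q (toSphere s (polyBracket f g)) = (-Complex.I) • (Q (toSphere s f) * Q (toSphere s g)
      - Q (toSphere s g) * Q (toSphere s f)) := by
  rw [← poissonBracket_toSphere, hQ.map_bracket]

/-- The kernel of a Lie homomorphism is a Lie ideal. -/
theorem map_polyBracket_eq_zero (hQ : IsQuantization Q) {f : MvPolynomial (Fin 3) ℝ}
    (hf : Q (toSphere s f) = 0) (g : MvPolynomial (Fin 3) ℝ) :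
    Q (toSphere s (polyBracket f g)) = 0 := by
  rw [hQ.map_polyBracket, hf]; simp

theorem norm_map_polyBracket_le (hQ : IsQuantization Q) (f g : MvPolynomial (Fin 3) ℝ) :
    ‖Q (toSphere s (polyBracket f g))‖ ≤ 2 * ‖Q (toSphere s g)‖ * ‖Q (toSphere s f)‖ := by
  rw [hQ.map_polyBracket, norm_smul, norm_neg, Complex.norm_I, one_mul]
  refine (norm_sub_le _ _).trans ?_
  have h1 := norm_mul_le (Q (toSphere s f)) (Q (toSphere s g))
  have h2 := norm_mul_le (Q (toSphere s g)) (Q (toSphere s f))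
  linarith

/-- Boundedness of `Q S₃` annihilates the sectorial polynomials of large degree. -/
theorem map_sectorial_eq_zero_of_lt (hQ : IsQuantization Q) {n : ℕ}
    (hn : 2 * ‖Q (toSphere s (X 2))‖ < n) :
    Q (toSphere s (sectorial n).1) = 0 ∧ Q (toSphere s (sectorial n).2) = 0 := by
  have h1 := hQ.norm_map_polyBracket_le (sectorial n).1 (X 2)
  have h2 := hQ.norm_map_polyBracket_le (sectorial n).2 (X 2)
  rw [polyBracket_sectorial_fst_X_two, map_neg, map_neg, norm_neg, map_smul, map_smul, norm_smul,
    Real.norm_natCast] at h1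
  rw [polyBracket_sectorial_snd_X_two, map_smul, map_smul, norm_smul, Real.norm_natCast] at h2
  have ha := norm_nonneg (Q (toSphere s (sectorial n).1))
  have hb := norm_nonneg (Q (toSphere s (sectorial n).2))
  -- Adding `h1` and `h2` gives (n - 2‖Q S₃‖) times this sum ≤ 0, with a positive factor.
  have hsum : ‖Q (toSphere s (sectorial n).1)‖ + ‖Q (toSphere s (sectorial n).2)‖ ≤ 0 := by
    nlinarith
  exact ⟨norm_eq_zero.1 (by linarith), norm_eq_zero.1 (by linarith)⟩

theorem map_X_two_mul_sectorial_eq_zero (hQ : IsQuantization Q) {n : ℕ} (hn : n ≠ 0)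
    (h1 : Q (toSphere s (sectorial n).1) = 0) (h2 : Q (toSphere s (sectorial n).2) = 0) :
    Q (toSphere s (X 2 * (sectorial n).1)) = 0 ∧ Q (toSphere s (X 2 * (sectorial n).2)) = 0 := by
  -- Bracketing with S₃² swaps real and imaginary parts, up to sign, and multiplies by 2n S₃; hence
  -- n ≠ 0.
  have k1 := hQ.map_polyBracket_eq_zero h2 (X 2 ^ 2)
  have k2 := hQ.map_polyBracket_eq_zero h1 (X 2 ^ 2)
  have e (c : ℝ) (f : MvPolynomial (Fin 3) ℝ) : 2 * (X 2 * c • f) = (2 * c) • (X 2 * f) := by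
    simp only [smul_eq_C_mul, map_mul, map_ofNat]; ring
  rw [polyBracket_X_two_sq, polyBracket_sectorial_snd_X_two, e, map_smul, map_smul] at k1
  rw [polyBracket_X_two_sq, polyBracket_sectorial_fst_X_two, ← neg_smul, e, map_smul,
    map_smul] at k2
  exact ⟨(smul_eq_zero.1 k1).resolve_left (by simpa using hn),
    (smul_eq_zero.1 k2).resolve_left (by simpa using hn)⟩

theorem map_sectorial_eq_zero_of_succ (hQ : IsQuantization Q) (hs : s ≠ 0) (n : ℕ)
    (h : Q (toSphere s (sectorial (n + 2)).1) = 0 ∧ Q (toSphere s (sectorial (n + 2)).2) = 0) :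
    Q (toSphere s (sectorial (n + 1)).1) = 0 ∧ Q (toSphere s (sectorial (n + 1)).2) = 0 := by
  obtain ⟨h1, h2⟩ := h
  obtain ⟨k1, k2⟩ := hQ.map_X_two_mul_sectorial_eq_zero (by lia) h1 h2
  -- This is 2m(m-1) for m = n + 2. It vanishes at m = 1, so the descent cannot reach the constant
  -- 1.
  have hc : 2 * ((n : ℝ) + 2) * ((n : ℝ) + 1) ≠ 0 := by positivity
  have hs2 : s ^ 2 ≠ 0 := pow_ne_zero 2 hs
  have e1 := congrArg (fun f => Q (toSphere s f)) (lowering_fst s n)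
  have e2 := congrArg (fun f => Q (toSphere s f)) (lowering_snd s n)
  simp only [map_sub, map_add, map_neg, map_smul, toSphere_rel_add_mul,
    hQ.map_polyBracket_eq_zero h1, hQ.map_polyBracket_eq_zero h2, hQ.map_polyBracket_eq_zero k1,
    hQ.map_polyBracket_eq_zero k2, add_zero, sub_zero, smul_zero] at e1 e2
  exact ⟨(smul_eq_zero.1 ((smul_eq_zero.1 (neg_eq_zero.1 e1.symm)).resolve_left hc)).resolve_left
    hs2, (smul_eq_zero.1 ((smul_eq_zero.1 e2.symm).resolve_left hc)).resolve_left hs2⟩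

/-- Every quantization by bounded operators, irreducible or not, annihilates the spin vector. -/
theorem isSpinZero (hQ : IsQuantization Q) (hs : s ≠ 0) : IsSpinZero Q := by
  obtain ⟨N, hN⟩ := exists_nat_gt (2 * ‖Q (toSphere s (X 2))‖)
  have hdesc (n : ℕ) : Q (toSphere s (sectorial (n + 1)).1) = 0 ∧
      Q (toSphere s (sectorial (n + 1)).2) = 0 →
      Q (toSphere s (sectorial 1).1) = 0 ∧ Q (toSphere s (sectorial 1).2) = 0 := by
    induction n with
    | zero => exact id
    | succ n ih => exact fun h => ih (hQ.map_sectorial_eq_zero_of_succ hs n h)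
  obtain ⟨h0, h1⟩ := hdesc N (hQ.map_sectorial_eq_zero_of_lt (hN.trans (by simp)))
  replace h0 : Q (toSphere s (X 0)) = 0 := by simpa [sectorial] using h0
  replace h1 : Q (toSphere s (X 1)) = 0 := by simpa [sectorial] using h1
  have h2 : Q (toSphere s (X 2)) = 0 := by
    have := hQ.map_polyBracket_eq_zero h0 (X 1)
    simpa [polyBracket, pderiv_X] using this
  intro i
  fin_cases i
  exacts [h0, h1, h2]

end IsQuantization

end SpinSphere

theorem theorem1 (s : ℝ) (hs : 0 < s) {H : Type*} [NormedAddCommGroup H]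
    [InnerProductSpace ℂ H] [CompleteSpace H] :
    ¬ ∃ Q : SpinSphere.SpherePoly s →ₗ[ℝ] (H →L[ℂ] H),
      SpinSphere.IsAdmissibleQuantization Q ∧ ¬ SpinSphere.IsSpinZero Q := by
  rintro ⟨Q, hQ, h⟩
  exact h (hQ.isQuantization.isSpinZero hs.ne')
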